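/- For integers $n\ge 0$ let $x_1,\dots,x_n$ be $n$ objects arrayed in a line (respectively, in a circle). For a set $N\subseteq\mathbb{N}=\{0,1,2,\dots\}$, a set $A$ of these objects is called $N$-separate if, whenever two distinct objects of $A$ have exactly $j$ objects between them, then $j\in N$; on the circle this is required for both arcs joining the two objects. For integers $p,m\ge 1$ and $n,k\ge 0$ put $N_m^p=\mathbb{N}\setminus\{m-1,2m-1,\dots,pm-1\}$ and let $\mathcal H_{p,n}^{m,k}$ (respectively $\mathcal G_{p,n}^{m,k}$) be the number of $N_m^p$-separate $k$-subsets of the $n$ objects arrayed in a line (respectively, in a circle). Put $\mathcal H_{p,n}^{m,k}=\mathcal G_{p,n}^{m,k}=0$ if $n<0$ or $k<0$. **Theorem.** Let $p,m,k\ge 1$ be integers. (1) For all $n\ge pm(k-1)$, $$\mathcal H_{p,n}^{m,k}=\mathcal H_{p,n-1}^{m,k}+\mathcal H_{p,n-p-1}^{m,k-1},$$ except when $m,k\ge 2$ and $n=pm(k-1)$, or when $k=1$ and $1\le n\le p$. (2) For all $n\ge m(pk+1)$, $$\mathcal G_{p,n}^{m,k}=\mathcal G_{p,n-1}^{m,k}+\mathcal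 G_{p,n-p-1}^{m,k-1},$$ except when $m=1$, $k=2$ and $n=2p+1$. (3) For all $n\ge m(pk+1)$, $$\mathcal G_{p,n}^{m,k}=\sum_{j=0}^{m}(-1)^j\binom{m}{j}p^j(p+1)^{m-j}\,\mathcal H_{p,n-pm-j}^{m,k}.$$ (4) For all $n\ge pm(k-1)$, $$\mathcal H_{p,n}^{m,k}=\sum_{j=0}^{k}(-1)^j\binom{m+j-1}{j}p^j\,\mathcal G_{p,n+pm-pj-j}^{m,k-j},$$ except when $m,k\ge 2$ and $n=pm(k-1)$, or when $m=1$ and $(p+1)(k-1)-p<n\le (p+1)(k-1)$. -/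

import Mathlib

namespace SeparateSubsets

/-- `LineGap a b j`: the objects with positions `a`, `b` in a row of `n` objects have exactly `j`
objects between them. -/
def LineGap {n : ℕ} (a b : Fin n) (j : ℕ) : Prop :=
  (Finset.Ioo (min a b) (max a b)).card = j

/-- `CircleGap a b j`: the objects with positions `a`, `b` on a circle of `n` objects have exactly
`j` objects between them, along one of the two arcs that join them: either the arc that consists of
the intermediate positions, or the arc that runs through the end of the numbering. -/
def CircleGap {n : ℕ} (a b : Fin n) (j : ℕ) : Prop :=
  (Finset.Ioo (min a b) (max a b)).card = j ∨ ((Finset.Icc (min a b) (max a b))ᶜ).card = j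

/-- `A ⊆ {x_1, …, x_n}`, arrayed in a line, is `N`-separate. -/
def IsLineSeparate {n : ℕ} (N : Set ℕ) (A : Finset (Fin n)) : Prop :=
  ∀ a ∈ A, ∀ b ∈ A, a ≠ b → ∀ j, LineGap a b j → j ∈ N

/-- `A ⊆ {x_1, …, x_n}`, arrayed in a circle, is `N`-separate. -/
def IsCircleSeparate {n : ℕ} (N : Set ℕ) (A : Finset (Fin n)) : Prop :=
  ∀ a ∈ A, ∀ b ∈ A, a ≠ b → ∀ j, CircleGap a b j → j ∈ N

/-- `ℕ ∖ {m - 1, 2 m - 1, …, p m - 1}`. -/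
def allowedGaps (p m : ℕ) : Set ℕ :=
  {j | ¬ ∃ i, 1 ≤ i ∧ i ≤ p ∧ j + 1 = i * m}

/-- The line number `H_{p,n}^{m,k}`: the number of `k`-subsets of a row of `n` objects that are
separate for `allowedGaps p m`; it is `0` if `n < 0` or `k < 0`. -/
noncomputable def lineNumber (p m : ℕ) (n k : ℤ) : ℤ :=
  if n < 0 ∨ k < 0 then 0
  else (Set.ncard {A : Finset (Fin n.toNat) |
    A.card = k.toNat ∧ IsLineSeparate (allowedGaps p m) A} : ℤ)

/-- The circle number `G_{p,n}^{m,k}`: the number of `k`-subsets of a circle of `n` objects that are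
separate for `allowedGaps p m`; it is `0` if `n < 0` or `k < 0`. -/
noncomputable def circleNumber (p m : ℕ) (n k : ℤ) : ℤ :=
  if n < 0 ∨ k < 0 then 0
  else (Set.ncard {A : Finset (Fin n.toNat) |
    A.card = k.toNat ∧ IsCircleSeparate (allowedGaps p m) A} : ℤ)

end SeparateSubsets

/-!
Steps of length `m` split the row of `n` objects into its residue classes modulo `m`, and the
circle into `gcd n m` circles of length `n / gcd n m`. On each piece two objects exclude each other
exactly when their distance is at most `p`. So the generating polynomials of the line and circle
numbers are products of independence polynomials of paths (`linePoly_eq_prod`) and cycles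
(`circlePoly_eq_pow`). The path polynomials satisfy `F (n + 1) = F n + x F (n - p)`
(`pathPoly_succ`), and a cycle is a combination of two paths (`circlePoly_one`).

The characteristic equation `t ^ (p + 1) = t ^ p + x` of this recurrence has one root `l = 1 + ⋯`
that is a power series in `x`; the other roots are small. Up to an order in `x` that grows with
`n`, the polynomial `F n` is therefore a constant times `l ^ n`. To avoid the power series `l`,
everything is expressed in the variable `y = l - 1`: then `x = y (1 + y) ^ p` is a polynomial in
`y`, and this substitution (`substHom`) preserves orders of vanishing
(`X_pow_dvd_of_dvd_substHom`). With `slope p = 1 + (p + 1) y` the estimates, modulo `y ^ (k + 1)`,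
read

* `slope p ^ m * H n = l ^ (n + m (p + 1))` for the line when `p m (k - 1) ≤ n`
  (`dvd_substHom_linePoly`),
* `G n = l ^ n` for the circle when `p m k < n`, or when `k ≤ 1` (`isCirclePower`,
  `isCirclePower_of_le_one`).

The recurrences express `l ^ (p + 1) = l ^ p + x`. The formula for `G` in terms of `H` is the
binomial expansion of `slope p ^ m = ((p + 1) l - p) ^ m`, and the one for `H` in terms of `G` the
expansion of `(l + p y) ^ (-m)` in powers of `y / l = x / l ^ (p + 1)`
(`dvd_pow_sub_mul_sum_multichoose`). The few remaining lengths occur only for `m = 1` or `n = 0`,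
where all the numbers involved vanish (`coeff_linePoly_one_eq_zero`,
`coeff_circlePoly_one_eq_zero`).
-/

namespace SeparateSubsets

open Polynomial Finset

/-! ### Independence polynomials -/

/-- No two distinct elements of `A` are related by `R`. -/
def IsIndep {V : Type*} (R : V → V → Prop) (A : Finset V) : Prop :=
  ∀ a ∈ A, ∀ b ∈ A, a ≠ b → ¬ R a b

open Classical in
/-- The independence polynomial of the graph induced by `R` on `S`: the coefficient of `X ^ k` is
the number of independent `k`-subsets of `S`. The relation `R` need be neither symmetric nor
irreflexive. -/
noncomputable def indepPoly {V : Type*} (R : V → V → Prop) (S : Finset V) : ℤ[X] :=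
  ∑ A ∈ S.powerset with IsIndep R A, X ^ A.card

section indepPoly

variable {V W : Type*} {R : V → V → Prop} {R' : W → W → Prop}

@[simp]
lemma indepPoly_empty : indepPoly R ∅ = 1 := by
  classical
  have : IsIndep R ∅ := by simp [IsIndep]
  simp [indepPoly, Finset.filter_singleton, this]

open Classical in
lemma coeff_indepPoly (S : Finset V) (k : ℕ) :
    (indepPoly R S).coeff k = #{A ∈ S.powerset | IsIndep R A ∧ A.card = k} := by
  simp only [indepPoly, finsetSum_coeff, coeff_X_pow, Finset.sum_boole, Finset.filter_filter,
    eq_comm]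

open Classical in
/-- Deletion of a vertex `v`: an independent set either avoids `v`, or consists of `v` and an
independent set of vertices not related to `v`. -/
lemma indepPoly_insert [DecidableEq V] {S : Finset V} {v : V} (hv : v ∉ S) :
    indepPoly R (insert v S) =
      indepPoly R S + X * indepPoly R {a ∈ S | ¬ R v a ∧ ¬ R a v} := by
  unfold indepPoly
  rw [Finset.powerset_insert, Finset.filter_union, Finset.sum_union, Finset.filter_image,
    Finset.sum_image, Finset.mul_sum]
  · congr 1
    have hset : {A ∈ S.powerset | IsIndep R (insert v A)} =
        {A ∈ ({a ∈ S | ¬ R v a ∧ ¬ R a v} : Finset V).powerset | IsIndep R A} := by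
      ext A
      simp only [Finset.mem_filter, Finset.mem_powerset]
      constructor
      · rintro ⟨hA, hi⟩
        refine ⟨fun a ha => Finset.mem_filter.2 ⟨hA ha, ?_, ?_⟩, fun a ha b hb =>
          hi a (Finset.mem_insert_of_mem ha) b (Finset.mem_insert_of_mem hb)⟩
        · exact hi v (Finset.mem_insert_self _ _) a (Finset.mem_insert_of_mem ha)
            (fun h => hv (h ▸ hA ha))
        · exact hi a (Finset.mem_insert_of_mem ha) v (Finset.mem_insert_self _ _)
            (fun h => hv (h ▸ hA ha))
      · rintro ⟨hA, hi⟩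
        refine ⟨fun a ha => (Finset.mem_filter.1 (hA ha)).1, fun a ha b hb hab => ?_⟩
        rcases Finset.mem_insert.1 ha with rfl | ha' <;>
          rcases Finset.mem_insert.1 hb with rfl | hb'
        · exact absurd rfl hab
        · exact (Finset.mem_filter.1 (hA hb')).2.1
        · exact (Finset.mem_filter.1 (hA ha')).2.2
        · exact hi a ha' b hb' hab
    rw [hset]
    refine Finset.sum_congr rfl fun A hA => ?_
    have hvA : v ∉ A := fun h => hv
      (Finset.mem_filter.1 (Finset.mem_powerset.1 (Finset.mem_filter.1 hA).1 h)).1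
    rw [Finset.card_insert_of_notMem hvA, pow_succ']
  · intro A hA B hB hAB
    have hA' : v ∉ A := fun h => hv (Finset.mem_powerset.1 (Finset.mem_filter.1 hA).1 h)
    have hB' : v ∉ B := fun h => hv (Finset.mem_powerset.1 (Finset.mem_filter.1 hB).1 h)
    rw [← Finset.erase_insert hA', ← Finset.erase_insert hB', hAB]
  · rw [Finset.disjoint_left]
    intro A hA hA'
    obtain ⟨B, -, rfl⟩ := Finset.mem_image.1 (Finset.mem_filter.1 hA').1
    exact hv (Finset.mem_powerset.1 (Finset.mem_filter.1 hA).1 (Finset.mem_insert_self _ _))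

open Classical in
lemma indepPoly_image [DecidableEq W] {S : Finset V} (f : V → W) (hf : Set.InjOn f S)
    (hR : ∀ a ∈ S, ∀ b ∈ S, a ≠ b → (R' (f a) (f b) ↔ R a b)) :
    indepPoly R' (S.image f) = indepPoly R S := by
  induction S using Finset.strongInduction with
  | H S ih =>
    rcases S.eq_empty_or_nonempty with rfl | ⟨v, hv⟩
    · simp
    have hsub : S.erase v ⊂ S := Finset.erase_ssubset hv
    have hmem : ∀ a ∈ S.erase v, a ∈ S := fun a ha => Finset.mem_of_mem_erase ha
    have hins : S = insert v (S.erase v) := (Finset.insert_erase hv).symm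
    have hfv : f v ∉ (S.erase v).image f := by
      intro h
      obtain ⟨a, ha, hav⟩ := Finset.mem_image.1 h
      exact Finset.ne_of_mem_erase ha (hf (hmem a ha) hv hav)
    have hfil : ({w ∈ (S.erase v).image f | ¬ R' (f v) w ∧ ¬ R' w (f v)} : Finset W) =
        ({a ∈ S.erase v | ¬ R v a ∧ ¬ R a v} : Finset V).image f := by
      rw [Finset.filter_image]
      congr 1
      refine Finset.filter_congr fun a ha => ?_
      have hne := Finset.ne_of_mem_erase ha
      rw [hR v hv a (hmem a ha) hne.symm, hR a (hmem a ha) v hv hne]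
    conv_lhs => rw [hins, Finset.image_insert, indepPoly_insert hfv, hfil]
    conv_rhs => rw [hins, indepPoly_insert (Finset.notMem_erase v S)]
    have hsub' : ({a ∈ S.erase v | ¬ R v a ∧ ¬ R a v} : Finset V) ⊆ S.erase v :=
      Finset.filter_subset _ _
    rw [ih _ hsub (hf.mono hsub.1) (fun a ha b hb => hR a (hsub.1 ha) b (hsub.1 hb)),
      ih _ (hsub'.trans_ssubset hsub) (hf.mono (hsub'.trans hsub.1))
        (fun a ha b hb => hR a (hsub.1 (hsub' ha)) b (hsub.1 (hsub' hb)))]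

lemma indepPoly_congr {R₁ R₂ : V → V → Prop} {S : Finset V}
    (hR : ∀ a ∈ S, ∀ b ∈ S, a ≠ b → (R₁ a b ↔ R₂ a b)) :
    indepPoly R₁ S = indepPoly R₂ S := by
  classical
  simpa using indepPoly_image (R' := R₁) (R := R₂) (S := S) id Function.injective_id.injOn hR

open Classical in
lemma indepPoly_union [DecidableEq V] {S T : Finset V} (hST : Disjoint S T)
    (hR : ∀ a ∈ S, ∀ b ∈ T, ¬ R a b ∧ ¬ R b a) :
    indepPoly R (S ∪ T) = indepPoly R S * indepPoly R T := by
  induction T using Finset.strongInduction with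
  | H T ih =>
    rcases T.eq_empty_or_nonempty with rfl | ⟨v, hv⟩
    · simp
    have hsub : T.erase v ⊂ T := Finset.erase_ssubset hv
    have hins : T = insert v (T.erase v) := (Finset.insert_erase hv).symm
    have hvS : v ∉ S := fun h => (Finset.disjoint_left.1 hST) h hv
    have hvU : v ∉ S ∪ T.erase v := by simp [hvS]
    have hfil : ({a ∈ S ∪ T.erase v | ¬ R v a ∧ ¬ R a v} : Finset V) =
        S ∪ ({a ∈ T.erase v | ¬ R v a ∧ ¬ R a v} : Finset V) := by
      rw [Finset.filter_union, Finset.filter_true_of_mem]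
      exact fun a ha => ⟨(hR a ha v hv).2, (hR a ha v hv).1⟩
    have hsub' : ({a ∈ T.erase v | ¬ R v a ∧ ¬ R a v} : Finset V) ⊆ T.erase v :=
      Finset.filter_subset _ _
    conv_lhs => rw [hins, Finset.union_insert, indepPoly_insert hvU, hfil]
    conv_rhs => rw [hins, indepPoly_insert (Finset.notMem_erase v T)]
    rw [ih _ hsub (hST.mono_right hsub.1) (fun a ha b hb => hR a ha b (hsub.1 hb)),
      ih _ (hsub'.trans_ssubset hsub) (hST.mono_right (hsub'.trans hsub.1))
        (fun a ha b hb => hR a ha b (hsub.1 (hsub' hb)))]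
    ring

/-- If related elements of `S` have the same colour, the independence polynomial is the product
of those of the colour classes. -/
lemma indepPoly_eq_prod_fiber {ι : Type*} [DecidableEq ι] (S : Finset V) (g : V → ι)
    (T : Finset ι) (hg : ∀ a ∈ S, g a ∈ T) (hR : ∀ a ∈ S, ∀ b ∈ S, R a b → g a = g b) :
    indepPoly R S = ∏ i ∈ T, indepPoly R {a ∈ S | g a = i} := by
  classical
  have key : ∀ T : Finset ι,
      indepPoly R {a ∈ S | g a ∈ T} = ∏ i ∈ T, indepPoly R {a ∈ S | g a = i} := by
    intro T
    induction T using Finset.induction_on with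
    | empty => simp
    | insert i T hi ih =>
      rw [Finset.prod_insert hi, ← ih, ← indepPoly_union]
      · congr 1
        ext a
        simp only [Finset.mem_filter, Finset.mem_union, Finset.mem_insert]
        tauto
      · rw [Finset.disjoint_left]
        intro a ha hb
        rw [Finset.mem_filter] at ha hb
        exact hi (ha.2 ▸ hb.2)
      · intro a ha b hb
        rw [Finset.mem_filter] at ha hb
        refine ⟨fun h => hi ?_, fun h => hi ?_⟩
        · rw [← ha.2, hR a ha.1 b hb.1 h]
          exact hb.2
        · rw [← ha.2, ← hR b hb.1 a ha.1 h]
          exact hb.2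
  rw [← key T, Finset.filter_true_of_mem hg]

lemma coeff_zero_indepPoly (S : Finset V) : (indepPoly R S).coeff 0 = 1 := by
  classical
  rw [coeff_indepPoly]
  have : ({A ∈ S.powerset | IsIndep R A ∧ A.card = 0} : Finset (Finset V)) = {∅} := by
    ext A
    simp only [Finset.mem_filter, Finset.mem_powerset, Finset.card_eq_zero, Finset.mem_singleton]
    constructor
    · exact fun h => h.2.2
    · rintro rfl
      simp [IsIndep]
  rw [this, Finset.card_singleton, Nat.cast_one]

lemma coeff_one_indepPoly (S : Finset V) : (indepPoly R S).coeff 1 = S.card := by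
  classical
  rw [coeff_indepPoly]
  have : ({A ∈ S.powerset | IsIndep R A ∧ A.card = 1} : Finset (Finset V)) =
      S.powersetCard 1 := by
    ext A
    simp only [Finset.mem_filter, Finset.mem_powerset, Finset.mem_powersetCard]
    refine ⟨fun h => ⟨h.1, h.2.2⟩, fun h => ⟨h.1, ?_, h.2⟩⟩
    obtain ⟨a, rfl⟩ := Finset.card_eq_one.1 h.2
    simp [IsIndep]
  rw [this, Finset.card_powersetCard, Nat.choose_one_right]

end indepPoly

/-! ### The change of variable -/

/-- The substitution `X ↦ X (1 + X) ^ p` on integer polynomials. In terms of `l = 1 + X` the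
image `x` of the variable satisfies `l ^ (p + 1) = l ^ p + x`. -/
noncomputable def substHom (p : ℕ) : ℤ[X] →ₐ[ℤ] ℤ[X] := aeval (X * (1 + X) ^ p)

@[simp]
lemma substHom_X (p : ℕ) : substHom p X = X * (1 + X) ^ p := by simp [substHom]

@[simp]
lemma substHom_C (p : ℕ) (a : ℤ) : substHom p (C a) = C a := by simp [substHom]

lemma dvd_of_dvd_mul_of_coeff_zero {n : ℕ} {f g : ℤ[X]} (hf : f.coeff 0 = 1)
    (h : X ^ n ∣ f * g) : X ^ n ∣ g := by
  refine prime_X.pow_dvd_of_dvd_mul_left n (fun hX => ?_) h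
  rw [X_dvd_iff, hf] at hX
  exact one_ne_zero hX

lemma coeff_zero_one_add_X_pow (n : ℕ) : ((1 + X : ℤ[X]) ^ n).coeff 0 = 1 := by
  simp [coeff_zero_eq_eval_zero]

/-- The substitution is `X ↦ X * unit` up to any order, so it preserves the order of vanishing. -/
lemma X_pow_dvd_of_dvd_substHom (p n : ℕ) (D : ℤ[X]) (h : X ^ n ∣ substHom p D) : X ^ n ∣ D := by
  induction n generalizing D with
  | zero => simp
  | succ n ih =>
    have hD := D.divX_mul_X_add
    have hs : substHom p D = X * ((1 + X) ^ p * substHom p D.divX) + C (D.coeff 0) := by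
      conv_lhs => rw [← hD]
      rw [map_add, map_mul, substHom_X, substHom_C]
      ring
    have h0 : D.coeff 0 = 0 := by
      have : X ∣ substHom p D := (dvd_pow_self X n.succ_ne_zero).trans h
      rw [X_dvd_iff, hs] at this
      simpa using this
    rw [hs, h0, C_0, add_zero, pow_succ', mul_dvd_mul_iff_left X_ne_zero] at h
    have := ih _ (dvd_of_dvd_mul_of_coeff_zero (coeff_zero_one_add_X_pow p) h)
    rw [← hD, h0, C_0, add_zero, pow_succ]
    exact mul_dvd_mul_right this X

lemma coeff_eq_zero_of_dvd_substHom {p k : ℕ} {D : ℤ[X]} (h : X ^ (k + 1) ∣ substHom p D) :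
    D.coeff k = 0 :=
  X_pow_dvd_iff.1 (X_pow_dvd_of_dvd_substHom p _ D h) k k.lt_succ_self

/-- With `l = 1 + X`, the constant of proportionality between the independence polynomial of a
long path and a power of `l` is the inverse of `slope p = (p + 1) l - p`. -/
noncomputable def slope (p : ℕ) : ℤ[X] := 1 + ((p : ℤ[X]) + 1) * X

lemma coeff_zero_slope_pow (p m : ℕ) : (slope p ^ m).coeff 0 = 1 := by
  simp [slope, coeff_zero_eq_eval_zero]

/-! ### Paths -/

/-- `a` and `b` differ by one of `m, 2 m, …, p m`. -/
def stepRel (p m a b : ℕ) : Prop := ∃ i, 1 ≤ i ∧ i ≤ p ∧ (a + i * m = b ∨ b + i * m = a)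

lemma stepRel_one {p a b : ℕ} (hab : a ≠ b) : stepRel p 1 a b ↔ a ≤ b + p ∧ b ≤ a + p := by
  constructor
  · rintro ⟨i, h1, h2, h | h⟩ <;> omega
  · rintro ⟨h1, h2⟩
    rcases Nat.lt_or_gt_of_ne hab with h | h
    · exact ⟨b - a, by omega, by omega, by omega⟩
    · exact ⟨a - b, by omega, by omega, by omega⟩

/-- The independence polynomial of the path on `n` vertices in which vertices at distance at most
`p` are related. -/
noncomputable def pathPoly (p n : ℕ) : ℤ[X] := indepPoly (stepRel p 1) (range n)

/-- With truncated subtraction, this also holds for `n < p`, as `pathPoly p 0 = 1`. -/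
lemma pathPoly_succ (p n : ℕ) : pathPoly p (n + 1) = pathPoly p n + X * pathPoly p (n - p) := by
  classical
  unfold pathPoly
  rw [Finset.range_add_one, indepPoly_insert Finset.notMem_range_self]
  congr 3
  ext a
  simp only [Finset.mem_filter, Finset.mem_range]
  constructor
  · rintro ⟨h, h1, -⟩
    rw [stepRel_one (by omega)] at h1
    omega
  · intro h
    refine ⟨by omega, ?_, ?_⟩ <;> rw [stepRel_one (by omega)] <;> omega

lemma indepPoly_Ico {R : ℕ → ℕ → Prop} {p a b : ℕ}
    (hR : ∀ s ∈ Ico a b, ∀ t ∈ Ico a b, s ≠ t → (R s t ↔ s ≤ t + p ∧ t ≤ s + p)) :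
    indepPoly R (Ico a b) = pathPoly p (b - a) := by
  classical
  have himg : (range (b - a)).image (a + ·) = Ico a b := by
    rw [Finset.range_eq_Ico, Finset.image_add_left_Ico]
    rcases le_total a b with h | h
    · rw [add_zero, Nat.add_sub_cancel' h]
    · rw [Nat.sub_eq_zero_of_le h, Finset.Ico_self, Finset.Ico_eq_empty_of_le h]
  rw [← himg, pathPoly]
  refine indepPoly_image _ (add_right_injective a).injOn fun s hs t ht hst => ?_
  rw [stepRel_one hst, hR _ (himg ▸ Finset.mem_image_of_mem _ hs) _
    (himg ▸ Finset.mem_image_of_mem _ ht) (by simpa using hst)]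
  omega

/-- The recurrence of order `p + 1` for path polynomials has characteristic polynomial
`t ^ (p + 1) - t ^ p - x = (t - l) (t ^ p + X ∑ l ^ i t ^ (p - 1 - i))` with `l = 1 + X`; the
second factor, applied to the path polynomials, leaves a geometric sequence. The truncated
subtraction counts a path with a negative number of vertices as empty. -/
lemma substHom_pathPoly_relation (p n : ℕ) :
    substHom p (pathPoly p n) +
      X * ∑ i ∈ range p, (1 + X) ^ i * substHom p (pathPoly p (n + p - 1 - i - p)) =
      (1 + X) ^ (n + p) := by
  induction n with
  | zero =>
    have h : ∀ i ∈ range p, (1 + X : ℤ[X]) ^ i * substHom p (pathPoly p (0 + p - 1 - i - p)) =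
        (1 + X) ^ i := fun i _ => by
      rw [show 0 + p - 1 - i - p = 0 by omega]
      simp [pathPoly]
    rw [Finset.sum_congr rfl h]
    have := mul_geom_sum (1 + X : ℤ[X]) p
    rw [add_sub_cancel_left] at this
    rw [this]
    simp [pathPoly]
  | succ n ih =>
    rcases p with _ | p
    · simp only [Finset.range_zero, Finset.sum_empty, mul_zero, add_zero] at ih ⊢
      rw [pathPoly_succ, map_add, map_mul, substHom_X, Nat.sub_zero, ih]
      ring
    rw [Finset.sum_range_succ']
    rw [Finset.sum_range_succ] at ih
    have h : ∀ i ∈ range p, (1 + X : ℤ[X]) ^ (i + 1) *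
        substHom (p + 1) (pathPoly (p + 1) (n + 1 + (p + 1) - 1 - (i + 1) - (p + 1))) =
        (1 + X) * ((1 + X) ^ i *
          substHom (p + 1) (pathPoly (p + 1) (n + (p + 1) - 1 - i - (p + 1)))) := fun i _ => by
      rw [show n + 1 + (p + 1) - 1 - (i + 1) - (p + 1) = n + (p + 1) - 1 - i - (p + 1) by omega]
      ring
    rw [Finset.sum_congr rfl h, ← Finset.mul_sum, pathPoly_succ, map_add, map_mul, substHom_X,
      show n + 1 + (p + 1) - 1 - 0 - (p + 1) = n by omega]
    rw [show n + (p + 1) - 1 - p - (p + 1) = n - (p + 1) by omega] at ih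
    rw [show n + 1 + (p + 1) = (n + (p + 1)) + 1 by ring, pow_succ (1 + X) (n + (p + 1)), ← ih]
    ring

/-- To order `k`, the path polynomials form a geometric sequence of ratio `1 + X`. The hypothesis
is `p (k - 1) ≤ n`. -/
lemma dvd_substHom_pathPoly (p k n : ℕ) (h : p * k ≤ n + p) :
    X ^ (k + 1) ∣ slope p * substHom p (pathPoly p n) - (1 + X) ^ (n + p + 1) := by
  -- The index is shifted by `p`, so that the empty paths with `n < 0` start the induction.
  suffices H : ∀ k n, p * k ≤ n →
      X ^ (k + 1) ∣ slope p * substHom p (pathPoly p (n - p)) - (1 + X) ^ (n + 1) by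
    simpa using H k (n + p) h
  clear h k n
  intro k
  induction k with
  | zero =>
    intro n _
    rw [zero_add, pow_one, X_dvd_iff, coeff_sub, mul_coeff_zero, coeff_zero_one_add_X_pow]
    have h1 : (substHom p (pathPoly p (n - p))).coeff 0 = 1 := by
      have h2 : (substHom p (pathPoly p (n - p))).coeff 0 = (pathPoly p (n - p)).coeff 0 := by
        simp only [coeff_zero_eq_eval_zero, substHom]
        rw [← comp_eq_aeval, eval_comp]
        simp
      rw [h2, pathPoly, coeff_zero_indepPoly]
    rw [h1]
    rw [← pow_one (slope p), coeff_zero_slope_pow]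
    norm_num
  | succ k ih =>
    intro n hn
    obtain ⟨n, rfl⟩ : ∃ n', n = n' + p := ⟨n - p, by rw [mul_add] at hn; omega⟩
    have hrel := substHom_pathPoly_relation p n
    have hpow : (1 + X : ℤ[X]) ^ (n + p + 1) + X * ∑ i ∈ range p, (1 + X) ^ i *
        (1 + X) ^ (n + p - 1 - i + 1) = slope p * (1 + X) ^ (n + p) := by
      have h : ∀ i ∈ range p, (1 + X : ℤ[X]) ^ i * (1 + X) ^ (n + p - 1 - i + 1) =
          (1 + X) ^ (n + p) := fun i hi => by
        rw [Finset.mem_range] at hi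
        rw [← pow_add]
        congr 1
        omega
      rw [Finset.sum_congr rfl h, Finset.sum_const, Finset.card_range, slope, nsmul_eq_mul]
      ring
    have hE : slope p * substHom p (pathPoly p (n + p - p)) - (1 + X) ^ (n + p + 1) =
        -(X * ∑ i ∈ range p, (1 + X) ^ i *
          (slope p * substHom p (pathPoly p (n + p - 1 - i - p)) -
            (1 + X) ^ (n + p - 1 - i + 1))) := by
      simp only [mul_sub, Finset.sum_sub_distrib]
      have : ∑ i ∈ range p, (1 + X : ℤ[X]) ^ i *
          (slope p * substHom p (pathPoly p (n + p - 1 - i - p))) =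
          slope p * ∑ i ∈ range p, (1 + X) ^ i * substHom p (pathPoly p (n + p - 1 - i - p)) := by
        rw [Finset.mul_sum]
        exact Finset.sum_congr rfl fun i _ => by ring
      rw [this, Nat.add_sub_cancel]
      linear_combination slope p * hrel - hpow
    rw [hE, dvd_neg, pow_succ']
    refine mul_dvd_mul_left X (Finset.dvd_sum fun i hi => Dvd.dvd.mul_left (ih _ ?_) _)
    rw [Finset.mem_range] at hi
    rw [mul_add] at hn
    omega

/-! ### The line -/

/-- The generating polynomial of the line numbers. -/
noncomputable def linePoly (p m n : ℕ) : ℤ[X] := indepPoly (stepRel p m) (range n)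

/-- The residue class of `r` modulo `m` has `(n + (m - 1 - r)) / m` members below `n`. -/
lemma add_mul_lt_iff {m n r t : ℕ} (hr : r < m) :
    r + t * m < n ↔ t < (n + (m - 1 - r)) / m := by
  rw [Nat.lt_iff_add_one_le, Nat.lt_iff_add_one_le, Nat.le_div_iff_mul_le (by omega), add_mul]
  omega

lemma filter_mod_eq_image {m n r : ℕ} (hr : r < m) :
    ({a ∈ range n | a % m = r} : Finset ℕ) =
      (range ((n + (m - 1 - r)) / m)).image (fun t => r + t * m) := by
  ext a
  simp only [Finset.mem_filter, Finset.mem_range, Finset.mem_image, ← add_mul_lt_iff hr]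
  constructor
  · rintro ⟨h, rfl⟩
    have := Nat.mod_add_div' a m
    exact ⟨a / m, by omega, by omega⟩
  · rintro ⟨t, h, rfl⟩
    exact ⟨h, by rw [Nat.add_mul_mod_self_right, Nat.mod_eq_of_lt hr]⟩

lemma injective_add_mul {m : ℕ} (hm : 1 ≤ m) (r : ℕ) :
    Function.Injective (fun t => r + t * m) := fun _ _ hst =>
  Nat.eq_of_mul_eq_mul_right hm (Nat.add_left_cancel hst)

/-- The residue classes modulo `m` do not interact, and each is a path. -/
lemma linePoly_eq_prod {p m n : ℕ} (hm : 1 ≤ m) :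
    linePoly p m n = ∏ r ∈ range m, pathPoly p ((n + (m - 1 - r)) / m) := by
  classical
  rw [linePoly, indepPoly_eq_prod_fiber (range n) (· % m) (range m)
    (fun a _ => Finset.mem_range.2 (Nat.mod_lt _ hm))]
  · refine Finset.prod_congr rfl fun r hr => ?_
    rw [filter_mod_eq_image (Finset.mem_range.1 hr), pathPoly]
    refine indepPoly_image _ (injective_add_mul hm r).injOn fun _ _ _ _ _ => ?_
    have h : ∀ s t i, r + s * m + i * m = r + t * m ↔ s + i * 1 = t := fun s t i => by
      rw [← injective_add_mul hm r |>.eq_iff (a := s + i * 1)]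
      simp only [mul_one, add_mul, add_assoc]
    simp only [stepRel, h]
  · rintro a - b - ⟨i, -, -, rfl | rfl⟩ <;> simp

lemma sum_classes {m : ℕ} (hm : 1 ≤ m) (n : ℕ) :
    ∑ r ∈ range m, (n + (m - 1 - r)) / m = n := by
  have h := Finset.card_eq_sum_card_fiberwise (s := range n) (t := range m) (f := (· % m))
    (fun a _ => Finset.mem_coe.2 (Finset.mem_range.2 (Nat.mod_lt _ hm)))
  rw [Finset.card_range] at h
  conv_rhs => rw [h]
  refine Finset.sum_congr rfl fun r hr => ?_
  rw [filter_mod_eq_image (Finset.mem_range.1 hr),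
    Finset.card_image_of_injective _ (injective_add_mul hm r), Finset.card_range]

lemma dvd_prod_sub_prod {ι A : Type*} [CommRing A] (s : Finset ι) (d : A) (f g : ι → A)
    (h : ∀ i ∈ s, d ∣ f i - g i) : d ∣ ∏ i ∈ s, f i - ∏ i ∈ s, g i := by
  simp only [← Ideal.mem_span_singleton, ← Ideal.Quotient.eq, map_prod] at h ⊢
  exact Finset.prod_congr rfl h

/-- To order `k`, the line polynomials form a geometric sequence of ratio `1 + X`. The hypothesis
is `p m (k - 1) ≤ n`. -/
lemma dvd_substHom_linePoly {p m k n : ℕ} (hm : 1 ≤ m) (h : p * m * k ≤ n + p * m) :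
    X ^ (k + 1) ∣ slope p ^ m * substHom p (linePoly p m n) - (1 + X) ^ (n + m * (p + 1)) := by
  have hexp : (1 + X : ℤ[X]) ^ (n + m * (p + 1)) =
      ∏ r ∈ range m, (1 + X) ^ ((n + (m - 1 - r)) / m + p + 1) := by
    rw [Finset.prod_pow_eq_pow_sum]
    simp only [add_assoc _ p 1, Finset.sum_add_distrib, sum_classes hm, Finset.sum_const,
      Finset.card_range, smul_eq_mul, mul_add]
  have hslope : slope p ^ m = ∏ _r ∈ range m, slope p := by simp
  rw [hexp, linePoly_eq_prod hm, map_prod, hslope, ← Finset.prod_mul_distrib]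
  refine dvd_prod_sub_prod _ _ _ _ fun r _ => dvd_substHom_pathPoly p k _ ?_
  have h1 : p * k * m ≤ (n / m + p) * m + (m - 1) := by
    have := Nat.div_add_mod' n m
    have := Nat.mod_lt n hm
    nlinarith [Nat.sub_add_cancel hm]
  have h2 : p * k ≤ n / m + p := by
    by_contra hlt
    have : (n / m + p + 1) * m ≤ p * k * m := Nat.mul_le_mul_right m (by omega)
    rw [add_mul _ 1] at this
    omega
  have h3 : n / m ≤ (n + (m - 1 - r)) / m := Nat.div_le_div_right (Nat.le_add_right _ _)
  omega

/-! ### The circle -/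

/-- Some arc joining the positions `a` and `b` on a circle of `n` objects has length one of
`m, 2 m, …, p m`. -/
def circleRel (p m n a b : ℕ) : Prop :=
  ∃ i, 1 ≤ i ∧ i ≤ p ∧
    (a + i * m = b ∨ b + i * m = a ∨ (a < b ∧ b + i * m = a + n) ∨ (b < a ∧ a + i * m = b + n))

/-- The generating polynomial of the circle numbers. -/
noncomputable def circlePoly (p m n : ℕ) : ℤ[X] := indepPoly (circleRel p m n) (range n)

/-- `a` and `b` differ modulo `n` by one of `m, 2 m, …, p m`. -/
def modRel (p m n a b : ℕ) : Prop :=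
  ∃ i, 1 ≤ i ∧ i ≤ p ∧ (a + i * m ≡ b [MOD n] ∨ b + i * m ≡ a [MOD n])

lemma add_modEq_iff {n a b c : ℕ} (ha : a < n) (hb : b < n) (hc : c < n) :
    a + c ≡ b [MOD n] ↔ a + c = b ∨ a + c = b + n := by
  rw [Nat.ModEq, Nat.mod_eq_of_lt hb]
  rcases lt_or_ge (a + c) n with h | h
  · rw [Nat.mod_eq_of_lt h]
    omega
  · rw [Nat.mod_eq_sub_mod h, Nat.mod_eq_of_lt (by omega)]
    omega

lemma circleRel_iff_modRel {p m n a b : ℕ} (h : p * m < n) (ha : a < n) (hb : b < n) :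
    circleRel p m n a b ↔ modRel p m n a b := by
  refine exists_congr fun i => and_congr_right fun _ => and_congr_right fun hi => ?_
  have hlt : i * m < n := (Nat.mul_le_mul_right m hi).trans_lt h
  rw [add_modEq_iff ha hb hlt, add_modEq_iff hb ha hlt]
  omega

lemma circleRel_one_iff {p n a b : ℕ} (ha : a < n) (hb : b < n) (hab : a ≠ b) :
    circleRel p 1 n a b ↔ (a ≤ b + p ∧ b ≤ a + p) ∨ a + n ≤ b + p ∨ b + n ≤ a + p := by
  constructor
  · rintro ⟨i, h1, h2, h⟩
    omega
  · intro h
    rcases Nat.lt_or_gt_of_ne hab with hlt | hlt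
    · rcases le_or_gt b (a + p) with h' | h'
      · exact ⟨b - a, by omega, by omega, by omega⟩
      · exact ⟨a + n - b, by omega, by omega, by omega⟩
    · rcases le_or_gt a (b + p) with h' | h'
      · exact ⟨a - b, by omega, by omega, by omega⟩
      · exact ⟨b + n - a, by omega, by omega, by omega⟩

/-- Among `p` consecutive vertices of a cycle at most one is chosen. If none is, a path on `n - p`
vertices remains; if one is, a path on `n - 2 p - 1` vertices. -/
lemma circlePoly_one (p q : ℕ) :
    circlePoly p 1 (q + 2 * p + 1) = pathPoly p (q + p + 1) + (p : ℤ[X]) * X * pathPoly p q := by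
  classical
  set n := q + 2 * p + 1 with hn
  have key : ∀ j ≤ p, circlePoly p 1 n =
      indepPoly (circleRel p 1 n) (range (n - j)) + (j : ℤ[X]) * X * pathPoly p q := by
    intro j
    induction j with
    | zero => simp [circlePoly]
    | succ j ih =>
      intro hj
      have hfil : ({a ∈ range (n - (j + 1)) | ¬ circleRel p 1 n (n - (j + 1)) a ∧
          ¬ circleRel p 1 n a (n - (j + 1))} : Finset ℕ) = Ico (p - j) (q + (p - j)) := by
        ext a
        simp only [Finset.mem_filter, Finset.mem_range, Finset.mem_Ico]
        constructor
        · rintro ⟨h, h1, -⟩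
          rw [circleRel_one_iff (by omega) (by omega) (by omega)] at h1
          omega
        · intro h
          rw [circleRel_one_iff (by omega) (by omega) (by omega),
            circleRel_one_iff (by omega) (by omega) (by omega)]
          omega
      have hpath : indepPoly (circleRel p 1 n) (Ico (p - j) (q + (p - j))) = pathPoly p q := by
        rw [indepPoly_Ico (p := p), Nat.add_sub_cancel]
        intro s hs t ht hst
        rw [Finset.mem_Ico] at hs ht
        rw [circleRel_one_iff (by omega) (by omega) hst]
        omega
      rw [ih (by omega), show n - j = n - (j + 1) + 1 by omega, Finset.range_add_one,
        indepPoly_insert Finset.notMem_range_self, hfil, hpath]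
      push_cast
      ring
  rw [key p le_rfl, show n - p = q + p + 1 by omega, Finset.range_eq_Ico,
    indepPoly_Ico (p := p), Nat.sub_zero]
  intro s hs t ht hst
  rw [Finset.mem_Ico] at hs ht
  rw [circleRel_one_iff (by omega) (by omega) hst]
  omega

lemma dvd_substHom_circlePoly_one {p k n : ℕ} (hk : 2 ≤ k) (h : p * k < n) :
    X ^ (k + 1) ∣ substHom p (circlePoly p 1 n) - (1 + X) ^ n := by
  have h2 : p * 2 ≤ p * k := Nat.mul_le_mul_left p hk
  obtain ⟨q, rfl⟩ : ∃ q, n = q + 2 * p + 1 := ⟨n - (2 * p + 1), by omega⟩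
  obtain ⟨k, rfl⟩ : ∃ k', k = k' + 1 := ⟨k - 1, by omega⟩
  rw [mul_add, mul_one] at h
  refine dvd_of_dvd_mul_of_coeff_zero (f := slope p) (by simp [slope, coeff_zero_eq_eval_zero]) ?_
  have h1 := dvd_substHom_pathPoly p (k + 1) (q + p + 1) (by rw [mul_add]; omega)
  have h3 := mul_dvd_mul_left X (dvd_substHom_pathPoly p k q (by omega))
  rw [← pow_succ'] at h3
  have hE : slope p * (substHom p (circlePoly p 1 (q + 2 * p + 1)) - (1 + X) ^ (q + 2 * p + 1)) =
      (slope p * substHom p (pathPoly p (q + p + 1)) - (1 + X) ^ (q + p + 1 + p + 1)) +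
      ((p : ℤ[X]) * (1 + X) ^ p) *
        (X * (slope p * substHom p (pathPoly p q) - (1 + X) ^ (q + p + 1))) := by
    rw [circlePoly_one, map_add, map_mul, map_mul, map_natCast, substHom_X, slope]
    ring
  rw [hE]
  exact dvd_add h1 (h3.mul_left _)

lemma modEq_step_iff {m n r a b : ℕ} (hn : 0 < n) :
    (r + a * m) % n ≡ (r + b * m) % n [MOD n] ↔ a ≡ b [MOD n / n.gcd m] := by
  rw [Nat.ModEq, Nat.mod_mod, Nat.mod_mod, ← Nat.ModEq]
  constructor
  · exact fun h => Nat.ModEq.cancel_right_div_gcd hn (Nat.ModEq.add_left_cancel' r h)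
  · refine fun h => Nat.ModEq.add_left r ((h.mul_right' m).of_dvd ?_)
    obtain ⟨c, hc⟩ := Nat.gcd_dvd_right n m
    refine ⟨c, ?_⟩
    calc n / n.gcd m * m = n / n.gcd m * (n.gcd m * c) := by rw [← hc]
      _ = n * c := by rw [← mul_assoc, Nat.div_mul_cancel (Nat.gcd_dvd_left n m)]

/-- Steps of length `m` cut the circle of `n` objects into `gcd n m` circles of equal length. -/
lemma circlePoly_eq_pow {p m n : ℕ} (h : p * m < n) (hm : 1 ≤ m) :
    circlePoly p m n = circlePoly p 1 (n / n.gcd m) ^ n.gcd m := by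
  classical
  have hn : 0 < n := by omega
  set d := n.gcd m with hd
  have hdpos : 0 < d := Nat.gcd_pos_of_pos_left m hn
  have hdn : d ∣ n := Nat.gcd_dvd_left n m
  have hdm : d ∣ m := Nat.gcd_dvd_right n m
  have hN : p * 1 < n / d := by
    rw [mul_one, Nat.lt_div_iff_mul_lt_of_dvd hdpos.ne' hdn]
    exact (Nat.mul_le_mul_left p (Nat.le_of_dvd hm hdm)).trans_lt h
  have h1 : circlePoly p m n = indepPoly (modRel p m n) (range n) :=
    indepPoly_congr fun a ha b hb _ =>
      circleRel_iff_modRel h (Finset.mem_range.1 ha) (Finset.mem_range.1 hb)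
  have h2 : circlePoly p 1 (n / d) = indepPoly (modRel p 1 (n / d)) (range (n / d)) :=
    indepPoly_congr fun a ha b hb _ =>
      circleRel_iff_modRel hN (Finset.mem_range.1 ha) (Finset.mem_range.1 hb)
  have hmod : ∀ a b i : ℕ, a + i * m ≡ b [MOD n] → a % d = b % d := by
    intro a b i hab
    have h3 : a + i * m ≡ b [MOD d] := hab.of_dvd hdn
    have h4 : a + i * m ≡ a + 0 [MOD d] :=
      Nat.ModEq.add_left a ((Nat.modEq_zero_iff_dvd).2 (hdm.mul_left i))
    exact h4.symm.trans h3
  rw [h1, indepPoly_eq_prod_fiber (range n) (· % d) (range d)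
    (fun a _ => Finset.mem_range.2 (Nat.mod_lt _ hdpos))]
  · rw [Finset.prod_congr rfl (g := fun _ => circlePoly p 1 (n / d)), Finset.prod_const,
      Finset.card_range]
    intro r hr
    rw [Finset.mem_range] at hr
    have hinj : Set.InjOn (fun t => (r + t * m) % n) (range (n / d)) := by
      intro s hs t ht hst
      rw [Finset.mem_coe, Finset.mem_range] at hs ht
      have : (r + s * m) % n ≡ (r + t * m) % n [MOD n] := congrArg (· % n) hst
      exact ((modEq_step_iff hn).1 this).eq_of_lt_of_lt hs ht
    have himg : (range (n / d)).image (fun t => (r + t * m) % n) =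
        ({a ∈ range n | a % d = r} : Finset ℕ) := by
      refine Finset.eq_of_subset_of_card_le ?_ ?_
      · intro a ha
        obtain ⟨t, -, rfl⟩ := Finset.mem_image.1 ha
        rw [Finset.mem_filter, Finset.mem_range, Nat.mod_mod_of_dvd _ hdn]
        refine ⟨Nat.mod_lt _ hn, ?_⟩
        have h4 : r + t * m ≡ r + 0 [MOD d] :=
          Nat.ModEq.add_left r ((Nat.modEq_zero_iff_dvd).2 (hdm.mul_left t))
        rw [h4, add_zero, Nat.mod_eq_of_lt hr]
      · rw [filter_mod_eq_image hr, Finset.card_image_of_injective _ (injective_add_mul hdpos r),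
          Finset.card_image_of_injOn hinj, Finset.card_range, Finset.card_range]
        obtain ⟨c, hc⟩ := hdn
        rw [hc, Nat.mul_add_div hdpos, Nat.mul_div_cancel_left c hdpos,
          Nat.div_eq_of_lt (by omega), add_zero]
    rw [← himg, h2]
    refine indepPoly_image _ hinj fun a _ b _ _ => ?_
    have hstep : ∀ a b i : ℕ, (r + a * m) % n + i * m ≡ (r + b * m) % n [MOD n] ↔
        a + i * 1 ≡ b [MOD n / d] := by
      intro a b i
      rw [← modEq_step_iff hn (r := r)]
      have : (r + a * m) % n + i * m ≡ (r + (a + i * 1) * m) % n [MOD n] := by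
        rw [Nat.ModEq, Nat.mod_add_mod, Nat.mod_mod]
        congr 1
        ring
      exact ⟨fun h => this.symm.trans h, fun h => this.trans h⟩
    simp only [modRel, hstep]
  · rintro a - b - ⟨i, -, -, hab | hab⟩
    · exact hmod a b i hab
    · exact (hmod b a i hab).symm

/-- On a circle of `n` objects, to order `k`, the generating polynomial is the power `l ^ n`
of `l = 1 + X`. -/
def IsCirclePower (p m n k : ℕ) : Prop :=
  X ^ (k + 1) ∣ substHom p (circlePoly p m n) - (1 + X) ^ n

/-- Subsets with at most one element are separate on every circle, however short. -/
lemma isCirclePower_of_le_one {p m n k : ℕ} (hk : k ≤ 1) : IsCirclePower p m n k := by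
  refine (pow_dvd_pow X (show k + 1 ≤ 2 by omega)).trans ?_
  have h1 : (X : ℤ[X]) ^ 2 ∣ circlePoly p m n - (1 + (n : ℤ[X]) * X) := by
    rw [X_pow_dvd_iff]
    intro d hd
    interval_cases d
    · simp [circlePoly, coeff_zero_indepPoly]
    · simp [circlePoly, coeff_one_indepPoly, coeff_one]
  have h2 : (X : ℤ[X]) ^ 2 ∣ (1 + X) ^ n - (1 + (n : ℤ[X]) * X) := by
    rw [X_pow_dvd_iff]
    intro d hd
    interval_cases d <;> simp [coeff_one_add_X_pow, coeff_one]
  have h3 : (X : ℤ[X]) ∣ (1 + X) ^ p - 1 := by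
    rw [X_dvd_iff, coeff_sub, coeff_zero_one_add_X_pow]
    simp
  have h4 := map_dvd (substHom p) h1
  rw [map_pow, map_sub, map_add, map_mul, substHom_X, map_one, map_natCast, mul_pow] at h4
  have h5 := (mul_dvd_mul_left X h3).mul_left (n : ℤ[X])
  rw [← pow_two] at h5
  convert dvd_sub (dvd_add ((dvd_mul_right _ _).trans h4) h5) h2 using 1
  ring

lemma isCirclePower {p m n k : ℕ} (hm : 1 ≤ m) (h : p * m * k < n) : IsCirclePower p m n k := by
  rcases le_or_gt k 1 with hk | hk
  · exact isCirclePower_of_le_one hk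
  have hpm : p * m < n := (Nat.le_mul_of_pos_right _ (by omega)).trans_lt h
  have hn : 0 < n := by omega
  have hdpos : 0 < n.gcd m := Nat.gcd_pos_of_pos_left m hn
  have hlt : p * k < n / n.gcd m := by
    rw [Nat.lt_div_iff_mul_lt_of_dvd hdpos.ne' (Nat.gcd_dvd_left n m)]
    calc p * k * n.gcd m ≤ p * k * m :=
          Nat.mul_le_mul_left _ (Nat.le_of_dvd hm (Nat.gcd_dvd_right n m))
      _ = p * m * k := by ring
      _ < n := h
  have h1 := dvd_substHom_circlePoly_one hk hlt
  have h2 := h1.trans (sub_dvd_pow_sub_pow _ _ (n.gcd m))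
  rwa [← pow_mul, Nat.div_mul_cancel (Nat.gcd_dvd_left n m), ← map_pow,
    ← circlePoly_eq_pow hpm hm] at h2

/-! ### Counting separate subsets -/

lemma coeff_indepPoly_range (R : ℕ → ℕ → Prop) (n k : ℕ) :
    (indepPoly R (range n)).coeff k = (Set.ncard {A : Finset (Fin n) |
      A.card = k ∧ IsIndep (fun a b : Fin n => R a b) A} : ℤ) := by
  classical
  have himg : (Finset.univ : Finset (Fin n)).image (fun a : Fin n => (a : ℕ)) = range n := by
    ext a
    simp only [Finset.mem_image, Finset.mem_univ, true_and, Finset.mem_range]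
    exact ⟨fun ⟨b, hb⟩ => hb ▸ b.2, fun h => ⟨⟨a, h⟩, rfl⟩⟩
  rw [← himg, indepPoly_image (R := fun a b : Fin n => R a b) (fun a : Fin n => (a : ℕ))
    Fin.val_injective.injOn fun _ _ _ _ _ => Iff.rfl, coeff_indepPoly, ← Set.ncard_coe_finset]
  congr 2
  ext A
  simp [and_comm]

lemma card_Ioo_add_one {n : ℕ} {a b : Fin n} (h : a ≠ b) :
    #(Ioo (min a b) (max a b)) + 1 = max (a : ℕ) b - min (a : ℕ) b := by
  rw [Fin.card_Ioo, Fin.coe_max, Fin.coe_min]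
  have : (a : ℕ) ≠ b := fun h' => h (Fin.ext h')
  omega

lemma card_compl_Icc_add_one {n : ℕ} (a b : Fin n) :
    #(Icc (min a b) (max a b))ᶜ + 1 = n - (max (a : ℕ) b - min (a : ℕ) b) := by
  rw [Finset.card_compl, Fin.card_Icc, Fintype.card_fin, Fin.coe_max, Fin.coe_min]
  omega

lemma isLineSeparate_iff {p m n : ℕ} {A : Finset (Fin n)} :
    IsLineSeparate (allowedGaps p m) A ↔ IsIndep (fun a b : Fin n => stepRel p m a b) A := by
  refine forall₂_congr fun a _ => forall₂_congr fun b _ => forall_congr' fun hab => ?_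
  have hcard := card_Ioo_add_one hab
  simp only [LineGap, allowedGaps, forall_eq', Set.mem_ofPred_eq, stepRel, hcard]
  refine not_congr (exists_congr fun i => and_congr_right fun _ => and_congr_right fun _ => ?_)
  have : (a : ℕ) ≠ b := fun h' => hab (Fin.ext h')
  omega

lemma isCircleSeparate_iff {p m n : ℕ} {A : Finset (Fin n)} :
    IsCircleSeparate (allowedGaps p m) A ↔
      IsIndep (fun a b : Fin n => circleRel p m n a b) A := by
  refine forall₂_congr fun a _ => forall₂_congr fun b _ => forall_congr' fun hab => ?_
  have hcard := card_Ioo_add_one hab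
  have hcard' := card_compl_Icc_add_one a b
  simp only [CircleGap, allowedGaps, or_imp, forall_and, forall_eq', Set.mem_ofPred_eq, circleRel,
    hcard, hcard']
  rw [← not_or, ← exists_or]
  have : (a : ℕ) ≠ b := fun h' => hab (Fin.ext h')
  refine not_congr (exists_congr fun i => ?_)
  rw [← and_or_left, ← and_or_left]
  refine and_congr_right fun _ => and_congr_right fun _ => ?_
  omega

lemma lineNumber_natCast (p m n k : ℕ) : lineNumber p m n k = (linePoly p m n).coeff k := by
  rw [lineNumber, if_neg (by omega), linePoly, coeff_indepPoly_range]
  simp only [isLineSeparate_iff]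
  rfl

lemma circleNumber_natCast (p m n k : ℕ) :
    circleNumber p m n k = (circlePoly p m n).coeff k := by
  rw [circleNumber, if_neg (by omega), circlePoly, coeff_indepPoly_range]
  simp only [isCircleSeparate_iff]
  rfl

lemma lineNumber_of_neg {p m : ℕ} {n k : ℤ} (h : n < 0) : lineNumber p m n k = 0 := by
  rw [lineNumber, if_pos (Or.inl h)]

lemma circleNumber_of_neg {p m : ℕ} {n k : ℤ} (h : n < 0) : circleNumber p m n k = 0 := by
  rw [circleNumber, if_pos (Or.inl h)]

/-! ### Recurrences away from short lines and circles -/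

lemma coeff_linePoly_rec {p m q k : ℕ} (hm : 1 ≤ m) (h : p * m * k ≤ q + p) :
    (linePoly p m (q + p + 1)).coeff (k + 1) =
      (linePoly p m (q + p)).coeff (k + 1) + (linePoly p m q).coeff k := by
  have hpm : p ≤ p * m := Nat.le_mul_of_pos_right p hm
  have h1 := dvd_substHom_linePoly (p := p) (m := m) (k := k + 1) (n := q + p + 1) hm
    (by rw [mul_add]; omega)
  have h2 := dvd_substHom_linePoly (p := p) (m := m) (k := k + 1) (n := q + p) hm
    (by rw [mul_add]; omega)
  have h3 := mul_dvd_mul_left X (dvd_substHom_linePoly (p := p) (m := m) (k := k) (n := q) hm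
    (by omega))
  rw [← pow_succ'] at h3
  have key : (linePoly p m (q + p + 1) - linePoly p m (q + p) - X * linePoly p m q).coeff
      (k + 1) = 0 := by
    refine coeff_eq_zero_of_dvd_substHom (p := p)
      (dvd_of_dvd_mul_of_coeff_zero (coeff_zero_slope_pow p m) ?_)
    convert dvd_sub (dvd_sub h1 h2) (h3.mul_left ((1 + X) ^ p)) using 1
    rw [map_sub, map_sub, map_mul, substHom_X]
    ring
  rw [coeff_sub, coeff_sub, coeff_X_mul] at key
  linarith

lemma coeff_circlePoly_rec {p m q k : ℕ} (h1 : IsCirclePower p m (q + p + 1) (k + 1))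
    (h2 : IsCirclePower p m (q + p) (k + 1)) (h3 : IsCirclePower p m q k) :
    (circlePoly p m (q + p + 1)).coeff (k + 1) =
      (circlePoly p m (q + p)).coeff (k + 1) + (circlePoly p m q).coeff k := by
  have h3' := mul_dvd_mul_left X h3
  rw [← pow_succ'] at h3'
  have key : (circlePoly p m (q + p + 1) - circlePoly p m (q + p) - X * circlePoly p m q).coeff
      (k + 1) = 0 := by
    refine coeff_eq_zero_of_dvd_substHom (p := p) ?_
    convert dvd_sub (dvd_sub h1 h2) (h3'.mul_left ((1 + X) ^ p)) using 1
    rw [map_sub, map_sub, map_mul, substHom_X]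
    ring
  rw [coeff_sub, coeff_sub, coeff_X_mul] at key
  linarith

/-- This is the binomial expansion of `slope p ^ m = ((p + 1) l - p) ^ m` with `l = 1 + X`. -/
lemma coeff_circlePoly_eq_sum {p m k n : ℕ} (hm : 1 ≤ m) (h : p * m * k + m ≤ n)
    (hn : p * m + m ≤ n) (hG : IsCirclePower p m n k) :
    (circlePoly p m n).coeff k = ∑ j ∈ range (m + 1),
      (-1 : ℤ) ^ j * (m.choose j : ℤ) * (p : ℤ) ^ j * ((p : ℤ) + 1) ^ (m - j) *
        (linePoly p m (n - p * m - j)).coeff k := by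
  set c : ℕ → ℤ := fun j =>
    (-1 : ℤ) ^ j * (m.choose j : ℤ) * (p : ℤ) ^ j * ((p : ℤ) + 1) ^ (m - j) with hc
  have key : (circlePoly p m n - ∑ j ∈ range (m + 1), C (c j) * linePoly p m (n - p * m - j)).coeff
      k = 0 := by
    refine coeff_eq_zero_of_dvd_substHom (p := p)
      (dvd_of_dvd_mul_of_coeff_zero (coeff_zero_slope_pow p m) ?_)
    have hexp : slope p ^ m * (1 + X) ^ n = ∑ j ∈ range (m + 1),
        C (c j) * (1 + X) ^ (n - p * m - j + m * (p + 1)) := by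
      have hs : slope p = -(p : ℤ[X]) + ((p : ℤ[X]) + 1) * (1 + X) := by
        rw [slope]
        ring
      rw [hs, add_pow, Finset.sum_mul]
      refine Finset.sum_congr rfl fun j hj => ?_
      rw [Finset.mem_range] at hj
      have he : n - p * m - j + m * (p + 1) = (m - j) + n := by
        rw [mul_add, mul_comm m p]
        omega
      rw [he, hc, neg_pow, mul_pow]
      simp only [map_mul, map_pow, map_neg, map_one, map_add, map_natCast]
      ring
    have hE : slope p ^ m * substHom p (circlePoly p m n -
        ∑ j ∈ range (m + 1), C (c j) * linePoly p m (n - p * m - j)) =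
        slope p ^ m * (substHom p (circlePoly p m n) - (1 + X) ^ n) -
        ∑ j ∈ range (m + 1), C (c j) * (slope p ^ m * substHom p (linePoly p m (n - p * m - j)) -
          (1 + X) ^ (n - p * m - j + m * (p + 1))) := by
      simp only [mul_sub, Finset.sum_sub_distrib, ← hexp, map_sub, map_sum, map_mul]
      have : ∑ j ∈ range (m + 1), C (c j) *
          (slope p ^ m * substHom p (linePoly p m (n - p * m - j))) =
          slope p ^ m * ∑ j ∈ range (m + 1), substHom p (C (c j)) *
            substHom p (linePoly p m (n - p * m - j)) := by
        rw [Finset.mul_sum]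
        refine Finset.sum_congr rfl fun j _ => ?_
        rw [substHom_C]
        ring
      rw [this]
      ring
    rw [hE]
    refine dvd_sub (hG.mul_left _) (Finset.dvd_sum fun j hj => ?_)
    rw [Finset.mem_range] at hj
    exact (dvd_substHom_linePoly hm (by omega)).mul_left _
  rw [coeff_sub, finsetSum_coeff, sub_eq_zero] at key
  simpa only [coeff_C_mul] using key

/-- The truncated expansion of `(1 - b / a) ^ (-m)`, homogenized. -/
lemma dvd_pow_sub_mul_sum_multichoose {A : Type*} [CommRing A] (a b : A) (m k : ℕ) :
    b ^ (k + 1) ∣ a ^ (m + k) -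
      (a - b) ^ m * ∑ j ∈ range (k + 1), (m.multichoose j : A) * b ^ j * a ^ (k - j) := by
  induction m with
  | zero =>
    rw [Finset.sum_range_succ']
    simp
  | succ m ih =>
    -- Pascal's rule makes the sum telescope after multiplication by `a - b`.
    have hstep : ∀ k : ℕ, (a - b) * ∑ j ∈ range (k + 1),
        ((m + 1).multichoose j : A) * b ^ j * a ^ (k - j) =
        a * ∑ j ∈ range (k + 1), (m.multichoose j : A) * b ^ j * a ^ (k - j) -
          ((m + 1).multichoose k : A) * b ^ (k + 1) := by
      intro k
      induction k with
      | zero => simp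
      | succ k ih =>
        have hpull : ∀ f : ℕ → A, ∑ j ∈ range (k + 1), f j * b ^ j * a ^ (k + 1 - j) =
            a * ∑ j ∈ range (k + 1), f j * b ^ j * a ^ (k - j) := fun f => by
          rw [Finset.mul_sum]
          refine Finset.sum_congr rfl fun j hj => ?_
          rw [Finset.mem_range] at hj
          rw [show k + 1 - j = k - j + 1 by omega]
          ring
        rw [Finset.sum_range_succ, Finset.sum_range_succ _ (k + 1), hpull, hpull,
          Nat.multichoose_succ_succ]
        push_cast
        rw [Nat.sub_self, pow_zero]
        linear_combination a * ih
    have hE : a ^ (m + 1 + k) - (a - b) ^ (m + 1) * ∑ j ∈ range (k + 1),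
        ((m + 1).multichoose j : A) * b ^ j * a ^ (k - j) =
        a * (a ^ (m + k) - (a - b) ^ m * ∑ j ∈ range (k + 1),
          (m.multichoose j : A) * b ^ j * a ^ (k - j)) +
        (a - b) ^ m * ((m + 1).multichoose k : A) * b ^ (k + 1) := by
      linear_combination (-(a - b) ^ m) * hstep k
    rw [hE]
    exact dvd_add (ih.mul_left a) (dvd_mul_left _ _)

/-- This is the expansion of `l ^ m / slope p ^ m = (1 + p X / l) ^ (-m)` in powers of `X / l`,
where `l = 1 + X`; the image of the variable under `substHom p` is `(X / l) l ^ (p + 1)`. -/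
lemma coeff_linePoly_eq_sum {p m k n : ℕ} (hm : 1 ≤ m) (h : p * m * k ≤ n + p * m)
    (N : ℕ → ℕ) (hN : ∀ j ≤ k, N j + (p + 1) * j = n + p * m)
    (hG : ∀ j ≤ k, IsCirclePower p m (N j) (k - j)) :
    (linePoly p m n).coeff k = ∑ j ∈ range (k + 1),
      (-1 : ℤ) ^ j * ((m + j - 1).choose j : ℤ) * (p : ℤ) ^ j *
        (circlePoly p m (N j)).coeff (k - j) := by
  set c : ℕ → ℤ := fun j =>
    (-1 : ℤ) ^ j * ((m + j - 1).choose j : ℤ) * (p : ℤ) ^ j with hc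
  have key : (linePoly p m n - ∑ j ∈ range (k + 1), C (c j) *
      (circlePoly p m (N j) * X ^ j)).coeff k = 0 := by
    refine coeff_eq_zero_of_dvd_substHom (p := p)
      (dvd_of_dvd_mul_of_coeff_zero (coeff_zero_one_add_X_pow k)
        (dvd_of_dvd_mul_of_coeff_zero (coeff_zero_slope_pow p m) ?_))
    have hexp := (dvd_pow_sub_mul_sum_multichoose (1 + X : ℤ[X]) (-(p : ℤ[X]) * X) m k).mul_left
      ((1 + X) ^ (n + p * m))
    have hX : (X : ℤ[X]) ^ (k + 1) ∣ (-(p : ℤ[X]) * X) ^ (k + 1) := by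
      rw [mul_pow]
      exact dvd_mul_left _ _
    have hexp' := hX.trans hexp
    have hs : (1 + X : ℤ[X]) - -(p : ℤ[X]) * X = slope p := by
      rw [slope]
      ring
    have hterm : (1 + X : ℤ[X]) ^ (n + p * m) * ∑ j ∈ range (k + 1),
        (m.multichoose j : ℤ[X]) * (-(p : ℤ[X]) * X) ^ j * (1 + X) ^ (k - j) =
        (1 + X) ^ k * ∑ j ∈ range (k + 1), C (c j) *
          ((1 + X) ^ N j * (X * (1 + X) ^ p) ^ j) := by
      rw [Finset.mul_sum, Finset.mul_sum]
      refine Finset.sum_congr rfl fun j hj => ?_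
      rw [Finset.mem_range] at hj
      have hjk : j ≤ k := by omega
      have he : (1 + X : ℤ[X]) ^ (n + p * m) * (1 + X) ^ (k - j) =
          (1 + X) ^ k * ((1 + X) ^ N j * ((1 + X) ^ p) ^ j) := by
        rw [← pow_mul, ← pow_add, ← pow_add, ← pow_add, ← hN j hjk, add_mul]
        congr 1
        omega
      rw [Nat.multichoose_eq, hc, mul_pow, mul_pow, neg_pow]
      simp only [map_mul, map_pow, map_neg, map_one, map_natCast]
      linear_combination ((-1) ^ j * (p : ℤ[X]) ^ j * ((m + j - 1).choose j : ℤ[X]) * X ^ j) * he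
    have hL := (dvd_substHom_linePoly hm h).mul_left ((1 + X) ^ k)
    have hC : X ^ (k + 1) ∣ ∑ j ∈ range (k + 1), C (c j) *
        ((substHom p (circlePoly p m (N j)) - (1 + X) ^ N j) * (X * (1 + X) ^ p) ^ j) := by
      refine Finset.dvd_sum fun j hj => Dvd.dvd.mul_left ?_ _
      rw [Finset.mem_range] at hj
      have hjk : k + 1 = (k - j + 1) + j := by omega
      rw [hjk, pow_add, mul_pow]
      exact mul_dvd_mul (hG j (by omega)) (dvd_mul_right _ _)
    rw [hs, mul_sub, mul_left_comm, hterm] at hexp'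
    simp only [sub_mul, mul_sub, Finset.sum_sub_distrib] at hC
    convert dvd_sub (dvd_add hL hexp') (hC.mul_left (slope p ^ m * (1 + X) ^ k)) using 1
    have hsub : ∀ j, substHom p (C (c j) * (circlePoly p m (N j) * X ^ j)) =
        C (c j) * (substHom p (circlePoly p m (N j)) * (X * (1 + X) ^ p) ^ j) := fun j => by
      rw [map_mul (substHom p), substHom_C, map_mul (substHom p), map_pow (substHom p), substHom_X]
    simp only [map_sub, map_sum, hsub]
    ring
  rw [coeff_sub, finsetSum_coeff, sub_eq_zero] at key
  rw [key]
  refine Finset.sum_congr rfl fun j hj => ?_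
  rw [Finset.mem_range] at hj
  rw [coeff_C_mul, coeff_mul_X_pow', if_pos (by omega)]

/-! ### Short lines and circles -/

lemma card_sub_one_mul_le {p lo hi : ℕ} {A : Finset ℕ} (hA : A ⊆ Icc lo hi)
    (hsep : ∀ a ∈ A, ∀ b ∈ A, a < b → a + p < b) : (p + 1) * (A.card - 1) ≤ hi - lo := by
  have hcard : A.card ≤ #(range ((hi - lo) / (p + 1) + 1)) := by
    refine Finset.card_le_card_of_injOn (fun a => (a - lo) / (p + 1)) ?_ ?_
    · intro a ha
      have := Finset.mem_Icc.1 (hA ha)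
      rw [Finset.mem_coe, Finset.mem_range, Nat.lt_succ_iff]
      exact Nat.div_le_div_right (by omega)
    · have key : ∀ a ∈ A, ∀ b ∈ A, a < b → (a - lo) / (p + 1) < (b - lo) / (p + 1) := by
        intro a ha b hb hab
        have h1 := Finset.mem_Icc.1 (hA ha)
        have h2 := hsep a ha b hb hab
        rw [Nat.lt_iff_add_one_le, ← Nat.add_div_right _ p.succ_pos]
        exact Nat.div_le_div_right (by omega)
      intro a ha b hb hab
      rcases lt_trichotomy a b with h | h | h
      · exact absurd hab (key a ha b hb h).ne
      · exact h
      · exact absurd hab (key b hb a ha h).ne'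
  rw [Finset.card_range] at hcard
  have hcard' : A.card - 1 ≤ (hi - lo) / (p + 1) := Nat.sub_le_iff_le_add.2 hcard
  exact (Nat.mul_le_mul_left _ hcard').trans (Nat.mul_div_le (hi - lo) (p + 1))

lemma coeff_linePoly_one_eq_zero {p n k : ℕ} (hk : 1 ≤ k) (h : n ≤ (p + 1) * (k - 1)) :
    (linePoly p 1 n).coeff k = 0 := by
  classical
  rw [linePoly, coeff_indepPoly, Finset.filter_eq_empty_iff.2, Finset.card_empty, Nat.cast_zero]
  rintro A hA ⟨hi, rfl⟩
  obtain ⟨a, ha⟩ := Finset.card_pos.1 hk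
  rw [Finset.mem_powerset] at hA
  have hn := Finset.mem_range.1 (hA ha)
  have := card_sub_one_mul_le (p := p) (lo := 0) (hi := n - 1) (A := A)
    (fun b hb => Finset.mem_Icc.2 (by have := Finset.mem_range.1 (hA hb); omega))
    fun a ha b hb hab => by
      have := hi a ha b hb hab.ne
      rw [stepRel_one hab.ne] at this
      omega
  omega

lemma coeff_circlePoly_one_eq_zero {p n k : ℕ} (hk : 2 ≤ k) (h : n < (p + 1) * k) :
    (circlePoly p 1 n).coeff k = 0 := by
  classical
  rw [circlePoly, coeff_indepPoly, Finset.filter_eq_empty_iff.2, Finset.card_empty, Nat.cast_zero]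
  rintro A hA ⟨hi, rfl⟩
  rw [Finset.mem_powerset] at hA
  have hne : A.Nonempty := Finset.card_pos.1 (by omega)
  have hmin := A.min'_mem hne
  have hmax := A.max'_mem hne
  have hlt : A.min' hne < A.max' hne := Finset.min'_lt_max'_of_card A (by omega)
  have hsep : ∀ a ∈ A, ∀ b ∈ A, a < b → a + p < b ∧ b + p < a + n := by
    intro a ha b hb hab
    have h1 := hi a ha b hb hab.ne
    rw [circleRel_one_iff (Finset.mem_range.1 (hA ha)) (Finset.mem_range.1 (hA hb)) hab.ne] at h1
    omega
  have h1 := card_sub_one_mul_le (p := p) (lo := A.min' hne) (hi := A.max' hne) (A := A)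
    (fun b hb => Finset.mem_Icc.2 ⟨A.min'_le b hb, A.le_max' b hb⟩)
    fun a ha b hb hab => (hsep a ha b hb hab).1
  have h2 := (hsep _ hmin _ hmax hlt).2
  obtain ⟨c, hc⟩ : ∃ c, A.card = c + 1 := ⟨A.card - 1, by omega⟩
  rw [hc, Nat.add_sub_cancel] at h1
  rw [hc, mul_add, mul_one] at h
  omega

/-! ### The four identities -/

lemma lineNumber_rec {p m k n : ℕ} (hp : 1 ≤ p) (hm : 1 ≤ m) (hk : 1 ≤ k)
    (hn : p * m * (k - 1) ≤ n) (h1 : ¬ (2 ≤ m ∧ 2 ≤ k ∧ n = p * m * (k - 1)))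
    (h2 : ¬ (k = 1 ∧ 1 ≤ n ∧ n ≤ p)) :
    lineNumber p m n k = lineNumber p m ((n : ℤ) - 1) k +
      lineNumber p m ((n : ℤ) - p - 1) ((k : ℤ) - 1) := by
  obtain ⟨k, rfl⟩ : ∃ k', k = k' + 1 := ⟨k - 1, by omega⟩
  rw [Nat.add_sub_cancel] at hn h1
  have hpm : p ≤ p * m := Nat.le_mul_of_pos_right p hm
  by_cases hlt : p * m * k < n ∧ p < n
  · obtain ⟨q, rfl⟩ : ∃ q, n = q + p + 1 := ⟨n - (p + 1), by omega⟩
    have := coeff_linePoly_rec (p := p) (m := m) (q := q) (k := k) hm (by omega)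
    rw [show ((q + p + 1 : ℕ) : ℤ) - 1 = (q + p : ℕ) by push_cast; ring,
      show ((q + p + 1 : ℕ) : ℤ) - p - 1 = q by push_cast; ring,
      show ((k + 1 : ℕ) : ℤ) - 1 = k by push_cast; ring]
    simpa only [lineNumber_natCast] using this
  rcases Nat.eq_zero_or_pos k with rfl | hkpos
  · -- Only `n = 0` is left, where all terms vanish.
    obtain rfl : n = 0 := by omega
    rw [lineNumber_of_neg (n := ((0 : ℕ) : ℤ) - 1) (by simp), lineNumber_of_neg
      (n := ((0 : ℕ) : ℤ) - p - 1) (by omega), lineNumber_natCast, linePoly]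
    simp [coeff_one]
  · -- Only `m = 1`, `n = p k` is left, where all terms vanish.
    have hkm : p * m ≤ p * m * k := Nat.le_mul_of_pos_right _ hkpos
    have hnk : n = p * m * k ∨ n = p := by omega
    have hm1 : m = 1 ∧ n = p * k := by
      rcases Nat.lt_or_ge 1 m with hm2 | hm2
      · have : p * 2 ≤ p * m := Nat.mul_le_mul_left p hm2
        exfalso
        omega
      · obtain rfl : m = 1 := by omega
        rw [mul_one] at *
        refine ⟨rfl, ?_⟩
        omega
    obtain ⟨rfl, rfl⟩ := hm1
    have hzero : ∀ a b : ℕ, a ≤ (p + 1) * b → lineNumber p 1 a ((b : ℤ) + 1) = 0 := by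
      intro a b hab
      have := coeff_linePoly_one_eq_zero (p := p) (n := a) (k := b + 1) (by omega) hab
      rw [← lineNumber_natCast] at this
      exact_mod_cast this
    obtain ⟨k, rfl⟩ : ∃ k', k = k' + 1 := ⟨k - 1, by omega⟩
    have h3 := hzero (p * (k + 1)) (k + 1) (Nat.mul_le_mul_right _ p.le_succ)
    have h4 := hzero (p * (k + 1) - 1) (k + 1)
      ((Nat.sub_le _ _).trans (Nat.mul_le_mul_right _ p.le_succ))
    have h5 : lineNumber p 1 (((p * (k + 1) : ℕ) : ℤ) - p - 1) ((k : ℤ) + 1) = 0 := by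
      rcases Nat.eq_zero_or_pos (p * k) with h0 | h0
      · exact lineNumber_of_neg (by push_cast; rw [mul_add]; push_cast [← Nat.cast_mul, h0]; omega)
      · have := hzero (p * k - 1) k ((Nat.sub_le _ _).trans (Nat.mul_le_mul_right _ p.le_succ))
        rw [show ((p * (k + 1) : ℕ) : ℤ) - p - 1 = (p * k - 1 : ℕ) by
          rw [Nat.cast_sub h0]; push_cast; ring]
        exact this
    have hpos : 1 ≤ p * (k + 1) := Nat.mul_pos hp k.succ_pos
    rw [Nat.cast_sub hpos, Nat.cast_one] at h4
    rw [show ((k + 1 + 1 : ℕ) : ℤ) = ((k + 1 : ℕ) : ℤ) + 1 by push_cast; ring, h3, h4,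
      add_sub_cancel_right, Nat.cast_succ k, h5, add_zero]

lemma circleNumber_rec {p m k n : ℕ} (hm : 1 ≤ m) (hk : 1 ≤ k)
    (hn : m * (p * k + 1) ≤ n) (h1 : ¬ (m = 1 ∧ k = 2 ∧ n = 2 * p + 1)) :
    circleNumber p m n k = circleNumber p m ((n : ℤ) - 1) k +
      circleNumber p m ((n : ℤ) - p - 1) ((k : ℤ) - 1) := by
  obtain ⟨k, rfl⟩ : ∃ k', k = k' + 1 := ⟨k - 1, by omega⟩
  have hpm : p ≤ p * m := Nat.le_mul_of_pos_right p hm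
  have hmul : m * (p * (k + 1) + 1) = p * m * k + p * m + m := by ring
  rw [hmul] at hn
  obtain ⟨q, rfl⟩ : ∃ q, n = q + p + 1 := ⟨n - (p + 1), by omega⟩
  rw [show ((q + p + 1 : ℕ) : ℤ) - 1 = (q + p : ℕ) by push_cast; ring,
    show ((q + p + 1 : ℕ) : ℤ) - p - 1 = q by push_cast; ring,
    show ((k + 1 : ℕ) : ℤ) - 1 = k by push_cast; ring]
  simp only [circleNumber_natCast]
  have hlong : p * m * (k + 1) < q + p + 1 := by rw [mul_add]; omega
  by_cases hlt : p * m * (k + 1) < q + p ∧ p * m * k < q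
  · exact coeff_circlePoly_rec (isCirclePower hm hlong) (isCirclePower hm hlt.1)
      (isCirclePower hm hlt.2)
  rcases Nat.eq_zero_or_pos k with rfl | hkpos
  · exact coeff_circlePoly_rec (isCirclePower_of_le_one le_rfl) (isCirclePower_of_le_one le_rfl)
      (isCirclePower_of_le_one zero_le_one)
  -- Only `m = 1`, `q = p k` with `k ≥ 2` is left, where all terms vanish.
  rw [mul_add] at hlt
  have hm1 : m = 1 := by
    by_contra hm1
    have : p * 2 ≤ p * m := Nat.mul_le_mul_left p (by omega)
    omega
  subst hm1
  simp only [mul_one, true_and] at hlt hn h1 ⊢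
  have hq : q = p * k := by omega
  have hk2 : 2 ≤ k := by
    by_contra hk2
    obtain rfl : k = 1 := by omega
    omega
  rw [coeff_circlePoly_one_eq_zero (by omega) (by simp only [add_mul, mul_add]; omega),
    coeff_circlePoly_one_eq_zero (by omega) (by simp only [add_mul, mul_add]; omega),
    coeff_circlePoly_one_eq_zero hk2 (by rw [add_mul]; omega), add_zero]

lemma circleNumber_eq_sum {p m k n : ℕ} (hm : 1 ≤ m) (hk : 1 ≤ k)
    (hn : m * (p * k + 1) ≤ n) :
    circleNumber p m n k = ∑ j ∈ range (m + 1),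
      (-1 : ℤ) ^ j * (m.choose j : ℤ) * (p : ℤ) ^ j * ((p : ℤ) + 1) ^ (m - j) *
        lineNumber p m ((n : ℤ) - p * m - j) k := by
  rw [show m * (p * k + 1) = p * m * k + m by ring] at hn
  have hpm : p * m ≤ p * m * k := Nat.le_mul_of_pos_right _ hk
  rw [circleNumber_natCast, coeff_circlePoly_eq_sum hm hn (by omega)
    (isCirclePower hm (by omega))]
  refine Finset.sum_congr rfl fun j hj => ?_
  rw [Finset.mem_range] at hj
  rw [← lineNumber_natCast, Nat.cast_sub (by omega), Nat.cast_sub (by omega), Nat.cast_mul]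

lemma lineNumber_eq_sum {p m k n : ℕ} (hp : 1 ≤ p) (hm : 1 ≤ m) (hk : 1 ≤ k)
    (hn : p * m * (k - 1) ≤ n) (h1 : ¬ (2 ≤ m ∧ 2 ≤ k ∧ n = p * m * (k - 1)))
    (h2 : ¬ (m = 1 ∧ n ≤ (p + 1) * (k - 1) ∧ (p + 1) * (k - 1) < n + p)) :
    lineNumber p m n k = ∑ j ∈ range (k + 1),
      (-1 : ℤ) ^ j * ((m + j - 1).choose j : ℤ) * (p : ℤ) ^ j *
        circleNumber p m ((n : ℤ) + p * m - p * j - j) ((k : ℤ) - j) := by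
  have hpmk : p * m * k = p * m * (k - 1) + p * m := by
    conv_lhs => rw [← Nat.sub_add_cancel hk, mul_add, mul_one]
  have hpk : (p + 1) * k = (p + 1) * (k - 1) + (p + 1) := by
    conv_lhs => rw [← Nat.sub_add_cancel hk, mul_add, mul_one]
  by_cases hshort : m = 1 ∧ n ≤ (p + 1) * (k - 1)
  · -- All terms vanish.
    obtain ⟨rfl, hle⟩ := hshort
    have hle' : n + p ≤ (p + 1) * (k - 1) := by omega
    rw [lineNumber_natCast, coeff_linePoly_one_eq_zero hk hle, eq_comm]
    refine Finset.sum_eq_zero fun j hj => mul_eq_zero_of_right _ ?_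
    rw [Finset.mem_range] at hj
    obtain ⟨i, rfl⟩ : ∃ i, k = i + j := ⟨k - j, by omega⟩
    rw [Nat.cast_one, mul_one, Nat.cast_add, add_sub_cancel_right]
    rcases lt_or_ge ((n : ℤ) + p - p * j - j) 0 with hneg | hneg
    · exact circleNumber_of_neg hneg
    obtain ⟨N, hN⟩ := Int.eq_ofNat_of_zero_le hneg
    rw [hN, circleNumber_natCast]
    have hN' : N + (p + 1) * j = n + p := by
      zify
      linarith
    rw [mul_add (p + 1) i j] at hpk
    have hi : N + (p + 1) ≤ (p + 1) * i := by omega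
    rcases lt_trichotomy i 1 with h | rfl | h
    · obtain rfl : i = 0 := by omega
      omega
    · obtain rfl : N = 0 := by omega
      simp [circlePoly, coeff_one]
    · exact coeff_circlePoly_one_eq_zero h (by omega)
  have hlen : (p + 1) * k ≤ n + p * m := by
    rcases Nat.lt_or_ge 1 m with hm2 | hm2
    · have h3 : p * 2 * k ≤ p * m * k := Nat.mul_le_mul_right k (Nat.mul_le_mul_left p hm2)
      have h4 : (p + 1) * k ≤ p * 2 * k := Nat.mul_le_mul_right k (by omega)
      omega
    · obtain rfl : m = 1 := by omega
      omega
  have hle : ∀ j ≤ k, (p + 1) * j ≤ n + p * m := fun j hj =>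
    (Nat.mul_le_mul_left _ hj).trans hlen
  rw [lineNumber_natCast, coeff_linePoly_eq_sum hm (by omega)
    (fun j => n + p * m - (p + 1) * j) (fun j hj => Nat.sub_add_cancel (hle j hj))]
  · refine Finset.sum_congr rfl fun j hj => ?_
    rw [Finset.mem_range] at hj
    rw [← circleNumber_natCast, Nat.cast_sub (hle j (by omega)), Nat.cast_sub (by omega)]
    congr 2
    push_cast
    ring
  intro j hj
  obtain ⟨i, rfl⟩ : ∃ i, k = i + j := ⟨k - j, by omega⟩
  rw [Nat.add_sub_cancel]
  rcases Nat.lt_or_ge 1 i with hi | hi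
  · refine isCirclePower hm ?_
    rcases Nat.lt_or_ge 1 m with hm2 | hm2
    · have h3 : p * 2 * j ≤ p * m * j := Nat.mul_le_mul_right j (Nat.mul_le_mul_left p hm2)
      have h4 : (p + 1) * j ≤ p * 2 * j := Nat.mul_le_mul_right j (by omega)
      rw [mul_add (p * m)] at hpmk
      omega
    · obtain rfl : m = 1 := by omega
      simp only [mul_one, mul_add, add_mul, one_mul] at *
      omega
  · exact isCirclePower_of_le_one hi

end SeparateSubsets

theorem mainTheorem3 (p m k : ℕ) (hp : 1 ≤ p) (hm : 1 ≤ m) (hk : 1 ≤ k) :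
    (∀ n : ℕ, p * m * (k - 1) ≤ n →
      ¬ (2 ≤ m ∧ 2 ≤ k ∧ n = p * m * (k - 1)) →
      ¬ (k = 1 ∧ 1 ≤ n ∧ n ≤ p) →
      SeparateSubsets.lineNumber p m n k =
        SeparateSubsets.lineNumber p m ((n : ℤ) - 1) k
          + SeparateSubsets.lineNumber p m ((n : ℤ) - p - 1) ((k : ℤ) - 1)) ∧
    (∀ n : ℕ, m * (p * k + 1) ≤ n →
      ¬ (m = 1 ∧ k = 2 ∧ n = 2 * p + 1) →
      SeparateSubsets.circleNumber p m n k =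
        SeparateSubsets.circleNumber p m ((n : ℤ) - 1) k
          + SeparateSubsets.circleNumber p m ((n : ℤ) - p - 1) ((k : ℤ) - 1)) ∧
    (∀ n : ℕ, m * (p * k + 1) ≤ n →
      SeparateSubsets.circleNumber p m n k =
        ∑ j ∈ Finset.range (m + 1),
          (-1 : ℤ) ^ j * (m.choose j : ℤ) * (p : ℤ) ^ j * ((p : ℤ) + 1) ^ (m - j)
            * SeparateSubsets.lineNumber p m ((n : ℤ) - p * m - j) k) ∧
    (∀ n : ℕ, p * m * (k - 1) ≤ n →
      ¬ (2 ≤ m ∧ 2 ≤ k ∧ n = p * m * (k - 1)) →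
      ¬ (m = 1 ∧ n ≤ (p + 1) * (k - 1) ∧ (p + 1) * (k - 1) < n + p) →
      SeparateSubsets.lineNumber p m n k =
        ∑ j ∈ Finset.range (k + 1),
          (-1 : ℤ) ^ j * ((m + j - 1).choose j : ℤ) * (p : ℤ) ^ j
            * SeparateSubsets.circleNumber p m ((n : ℤ) + p * m - p * j - j) ((k : ℤ) - j)) := by
  exact ⟨fun n h1 h2 h3 => SeparateSubsets.lineNumber_rec hp hm hk h1 h2 h3,
    fun n h1 h2 => SeparateSubsets.circleNumber_rec hm hk h1 h2,
    fun n h1 => SeparateSubsets.circleNumber_eq_sum hm hk h1,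
    fun n h1 h2 h3 => SeparateSubsets.lineNumber_eq_sum hp hm hk h1 h2 h3⟩
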